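/- **Theorem.** Let $\{u_n\}_{n\ge 0}$ be one of the $15$ sporadic Apéry-like sequences. The six sequences of the second kind are - (**A**) $u_n=\sum_{k=0}^n\binom nk^3$; - (**B**) $u_n=\sum_{k=0}^n(-1)^k3^{n-3k}\binom n{3k}\binom{3k}{2k}\binom{2k}k$; - (**C**) $u_n=\sum_{k=0}^n\binom nk^2\binom{2k}k$; - (**D**, Apéry numbers $b_n$) $u_n=\sum_{k=0}^n\binom nk^2\binom{n+k}k$; - (**E**) $u_n=\sum_{k=0}^n4^{n-2k}\binom n{2k}\binom{2k}k^2$; - (**F**) $u_n=\sum_{k=0}^n(-1)^k8^{n-k}\binom nk\sum_{j=0}^k\binom kj^3$. The nine sequences of the first kind are - $(\delta)$ $u_n=\sum_{k=0}^n(-1)^k3^{n-3k}\binom n{3k}\binom{n+k}k\binom{3k}{2k}\binom{2k}k$; - $(\eta)$ $u_n=\sum_{k=0}^n(-1)^k\binom nk^3\left(\binom{4n-5k-1}{3n}+\binom{4n-5k}{3n}\right)$; - $(\alpha)$ $u_n=\sum_{k=0}^n\binom nk^2\binom{2k}k\binom{2n-2k}{n-k}$; - $(\epsilon)$ $u_n=\sum_{k=0}^n\binom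 nk^2\binom{2k}n^2$; - $(\zeta)$ $u_n=\sum_{k=0}^n\sum_{l=0}^n\binom nk^2\binom nl\binom kl\binom{k+l}n$; - $(\gamma)$ (Apéry numbers $a_n$) $u_n=\sum_{k=0}^n\binom nk^2\binom{n+k}k^2$; - $s_7$: $u_n=\sum_{k=0}^n\binom nk^2\binom{n+k}k\binom{2k}n$; - $s_{10}$: $u_n=\sum_{k=0}^n\binom nk^4$; - $s_{18}$: $u_n=\sum_{k=0}^n(-1)^k\binom nk\binom{2k}k\binom{2n-2k}{n-k}\left(\binom{2n-3k-1}n+\binom{2n-3k}n\right)$. Here $\binom mk=0$ if $m<0$ or $k>m$, so that $u_0=1$ in all cases. For an integer $x$ let $v_n(x)=\sum_{k=0}^n\binom nk(-x)^{n-k}u_k$. For an integer $\alpha$ let $M_\alpha=\gcd(v_1(\alpha),v_2(\alpha),v_3(\alpha))$ if the sequence is of the second kind and $M_\alpha=\gcd(v_1(\alpha),v_2(\alpha),v_3(\alpha),v_4(\alpha))$ if it is of the first kind. Then for every integer $\alpha$ there is a largest positive integer $N_\alpha$ such that $u_n\equiv\alpha^n\pmod{N_\alpha}$ for all $n\ge0$.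 For every integer $\alpha$, $N_\alpha$ divides $N_{u_1}$, and $$N_{u_1}=M_{u_1}=\begin{cases}\gcd(v_2(u_1),v_3(u_1))&\text{for the second kind},\\ \gcd(v_2(u_1),v_3(u_1),v_4(u_1))&\text{for the first kind}.\end{cases}$$ The values of $(u_1,N_{u_1})$ are: **A** $(2,6)$, **B** $(3,6)$, **C** $(3,6)$, **D** $(3,10)$, **E** $(4,4)$, **F** $(6,6)$, $(\delta)$ $(3,24)$, $(\eta)$ $(5,10)$, $(\alpha)$ $(4,12)$, $(\epsilon)$ $(4,24)$, $(\zeta)$ $(3,6)$, $(\gamma)$ $(5,24)$, $s_7$ $(4,8)$, $s_{10}$ $(2,2)$, $s_{18}$ $(6,6)$. In particular $u_n\equiv u_1^n\pmod{N_{u_1}}$ for all $n\ge 0$ with these values; for instance $b_n\equiv3^n\pmod{10}$, $a_n\equiv5^n\pmod{24}$, and $u_n\equiv3^n\pmod{24}$ for $(\delta)$. -/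

import Mathlib

/-- The binomial coefficient `m choose k` for an integer `m`, with the convention that it
vanishes when `m` is negative. -/
def chooseInt (m : ℤ) (k : ℕ) : ℤ :=
  if m < 0 then 0 else (m.toNat.choose k : ℤ)

/-- The two kinds of Apéry-like sequences. -/
inductive AperyKind where
  | first
  | second

/-- The names of the fifteen sporadic Apéry-like sequences. -/
inductive AperyLike where
  | A
  | B
  | C
  | D
  | E
  | F
  | delta
  | eta
  | alpha
  | epsilon
  | zeta
  | gamma
  | s7
  | s10
  | s18

namespace AperyLike

/-- Zagier's six sequences are of the second kind, the nine sequences of Almkvist-Zudilin and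
Cooper are of the first kind. -/
def kind : AperyLike → AperyKind
  | A => .second
  | B => .second
  | C => .second
  | D => .second
  | E => .second
  | F => .second
  | delta => .first
  | eta => .first
  | alpha => .first
  | epsilon => .first
  | zeta => .first
  | gamma => .first
  | s7 => .first
  | s10 => .first
  | s18 => .first

/-- The fifteen Apéry-like sequences `u`, given by their binomial sums. With `u 0 = 1` they are
the solutions of the recurrences
`(n+1)^2 u (n+1) - (A n^2 + A n + l) u n + B n^2 u (n-1) = 0` (second kind) and
`(n+1)^3 u (n+1) - (2n+1) (a n^2 + a n + b) u n + n (c n^2 + d) u (n-1) = 0` (first kind), with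
the parameters `(A, B, l)` and `(a, b, c, d)` displayed next to each formula.
Subtractions of natural numbers that occur in exponents truncate only where the summand
vanishes because of one of its binomial coefficients. -/
def seq : AperyLike → ℕ → ℤ
  -- (7, -8, 2), Franel numbers
  | A, n => ∑ k ∈ Finset.range (n + 1), (n.choose k : ℤ) ^ 3
  -- (9, 27, 3)
  | B, n => ∑ k ∈ Finset.range (n + 1),
      (-1) ^ k * 3 ^ (n - 3 * k) * (n.choose (3 * k) : ℤ) * ((3 * k).choose (2 * k) : ℤ)
        * ((2 * k).choose k : ℤ)
  -- (10, 9, 3)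
  | C, n => ∑ k ∈ Finset.range (n + 1), (n.choose k : ℤ) ^ 2 * ((2 * k).choose k : ℤ)
  -- (11, -1, 3), Apéry numbers attached to zeta(2)
  | D, n => ∑ k ∈ Finset.range (n + 1), (n.choose k : ℤ) ^ 2 * ((n + k).choose k : ℤ)
  -- (12, 32, 4)
  | E, n => ∑ k ∈ Finset.range (n + 1),
      4 ^ (n - 2 * k) * (n.choose (2 * k) : ℤ) * ((2 * k).choose k : ℤ) ^ 2
  -- (17, 72, 6)
  | F, n => ∑ k ∈ Finset.range (n + 1),
      (-1) ^ k * 8 ^ (n - k) * (n.choose k : ℤ)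
        * ∑ j ∈ Finset.range (k + 1), (k.choose j : ℤ) ^ 3
  -- (7, 3, 81, 0), Almkvist-Zudilin numbers
  | delta, n => ∑ k ∈ Finset.range (n + 1),
      (-1) ^ k * 3 ^ (n - 3 * k) * (n.choose (3 * k) : ℤ) * ((n + k).choose k : ℤ)
        * ((3 * k).choose (2 * k) : ℤ) * ((2 * k).choose k : ℤ)
  -- (11, 5, 125, 0)
  | eta, n => ∑ k ∈ Finset.range (n + 1),
      (-1) ^ k * (n.choose k : ℤ) ^ 3
        * (chooseInt (4 * (n : ℤ) - 5 * (k : ℤ) - 1) (3 * n)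
          + chooseInt (4 * (n : ℤ) - 5 * (k : ℤ)) (3 * n))
  -- (10, 4, 64, 0), Domb numbers
  | alpha, n => ∑ k ∈ Finset.range (n + 1),
      (n.choose k : ℤ) ^ 2 * ((2 * k).choose k : ℤ) * ((2 * n - 2 * k).choose (n - k) : ℤ)
  -- (12, 4, 16, 0)
  | epsilon, n => ∑ k ∈ Finset.range (n + 1), (n.choose k : ℤ) ^ 2 * ((2 * k).choose n : ℤ) ^ 2
  -- (9, 3, -27, 0)
  | zeta, n => ∑ k ∈ Finset.range (n + 1), ∑ l ∈ Finset.range (n + 1),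
      (n.choose k : ℤ) ^ 2 * (n.choose l : ℤ) * (k.choose l : ℤ) * ((k + l).choose n : ℤ)
  -- (17, 5, 1, 0), Apéry numbers attached to zeta(3)
  | gamma, n => ∑ k ∈ Finset.range (n + 1), (n.choose k : ℤ) ^ 2 * ((n + k).choose k : ℤ) ^ 2
  -- (13, 4, -27, 3)
  | s7, n => ∑ k ∈ Finset.range (n + 1),
      (n.choose k : ℤ) ^ 2 * ((n + k).choose k : ℤ) * ((2 * k).choose n : ℤ)
  -- (6, 2, -64, 4), Yang-Zudilin numbers
  | s10, n => ∑ k ∈ Finset.range (n + 1), (n.choose k : ℤ) ^ 4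
  -- (14, 6, 192, -12)
  | s18, n => ∑ k ∈ Finset.range (n + 1),
      (-1) ^ k * (n.choose k : ℤ) * ((2 * k).choose k : ℤ) * ((2 * n - 2 * k).choose (n - k) : ℤ)
        * (chooseInt (2 * (n : ℤ) - 3 * (k : ℤ) - 1) n
          + chooseInt (2 * (n : ℤ) - 3 * (k : ℤ)) n)

/-- The binomial transform `v n x = ∑ k ≤ n, (n choose k) (-x)^(n-k) u k` of an Apéry-like
sequence `u`, evaluated at an integer `x`. -/
def transform (s : AperyLike) (n : ℕ) (x : ℤ) : ℤ :=
  ∑ k ∈ Finset.range (n + 1), (n.choose k : ℤ) * (-x) ^ (n - k) * s.seq k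

/-- The positive integers `N` such that `u n ≡ α ^ n (mod N)` for all `n`. -/
def moduli (s : AperyLike) (α : ℤ) : Set ℕ :=
  {N : ℕ | 0 < N ∧ ∀ n : ℕ, s.seq n ≡ α ^ n [ZMOD (N : ℤ)]}

/-- `N_α`, the largest positive integer `N` such that `u n ≡ α ^ n (mod N)` for all `n`. -/
noncomputable def maxModulus (s : AperyLike) (α : ℤ) : ℕ :=
  sSup (s.moduli α)

/-- `M_α`, the greatest common divisor of `v_1(α), v_2(α), v_3(α)` for the second kind, and of
`v_1(α), v_2(α), v_3(α), v_4(α)` for the first kind. -/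
def gcdModulus (s : AperyLike) (α : ℤ) : ℕ :=
  match s.kind with
  | .second =>
      Nat.gcd (s.transform 1 α).natAbs
        (Nat.gcd (s.transform 2 α).natAbs (s.transform 3 α).natAbs)
  | .first =>
      Nat.gcd (s.transform 1 α).natAbs
        (Nat.gcd (s.transform 2 α).natAbs
          (Nat.gcd (s.transform 3 α).natAbs (s.transform 4 α).natAbs))

/-- The table of the values `u 1`. -/
def tableFirstTerm : AperyLike → ℤ
  | A => 2
  | B => 3
  | C => 3
  | D => 3
  | E => 4
  | F => 6
  | delta => 3
  | eta => 5
  | alpha => 4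
  | epsilon => 4
  | zeta => 3
  | gamma => 5
  | s7 => 4
  | s10 => 2
  | s18 => 6

/-- The table of the values `N_{u 1}`. -/
def tableModulus : AperyLike → ℕ
  | A => 6
  | B => 6
  | C => 6
  | D => 10
  | E => 4
  | F => 6
  | delta => 24
  | eta => 10
  | alpha => 12
  | epsilon => 24
  | zeta => 6
  | gamma => 24
  | s7 => 8
  | s10 => 2
  | s18 => 6

end AperyLike

open Finset

/-! ### Lucas congruences in `ZMod p` -/

/-! The upper bound on the moduli is formal. The binomial transform of `α ^ n` is `(α - α) ^ n`, so
an admissible modulus for `α` divides every `v_n(α)` with `n > 0` (`dvd_transform`). The case `n =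
1` of the congruence says `u_1 ≡ α`, so such a modulus is also admissible for `u_1`
(`moduli_subset`) and divides `M_{u_1}`, a number computed from `u_1, …, u_4`.

The content is the converse: the computed value is itself admissible (`seq_modEq`). Apart from A and
F, which are treated directly modulo 6, this is checked on coprime prime-power factors. Three
mechanisms do most of the work. Lucas: if the summand is multiplicative in base `p` digits, then so
is the sum, and since `t ^ p = t` in `ZMod p` it suffices to check `n < p` (`sum_eq_pow_of_lucas`).
Evenness of central binomial coefficients: most congruences modulo 2, 4 and 8 come from factoring
such coefficients out of the summand. For `gamma`, `epsilon` and `s7` modulo 8 this leaves a parity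
question about halved central binomials, solved by a recursion in `n / 2` (`sum_halfCentral_mul`).
Absorption: for `eta` modulo 5 and `s18` modulo 3 every summand vanishes unless `p ∣ n`, and then
Lucas descends to `n / p` (`sum_eq_zero_of_lucas`). -/

theorem choose_lucas {p : ℕ} [Fact p.Prime] (n k : ℕ) {a b : ℕ} (ha : a < p) (hb : b < p) :
    ((p * n + a).choose (p * k + b) : ZMod p) = n.choose k * a.choose b := by
  have h := (ZMod.natCast_eq_natCast_iff _ _ _).2
    (Choose.choose_modEq_choose_mod_mul_choose_div_nat (n := p * n + a) (k := p * k + b) (p := p))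
  have hp : 0 < p := by omega
  rw [h, Nat.mul_add_mod, Nat.mul_add_mod, Nat.mod_eq_of_lt ha, Nat.mod_eq_of_lt hb,
    Nat.mul_add_div hp, Nat.mul_add_div hp, Nat.div_eq_of_lt ha, Nat.div_eq_of_lt hb]
  rw [add_zero, add_zero, Nat.cast_mul, mul_comm]

/-- The Lucas congruence when the upper digit may carry, provided the carried digit is smaller
than the lower digit. -/
theorem choose_lucas_carry {p : ℕ} [Fact p.Prime] (n k : ℕ) {a b : ℕ} (ha : a < b + p)
    (hb : b < p) :
    ((p * n + a).choose (p * k + b) : ZMod p) = n.choose k * a.choose b := by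
  rcases lt_or_ge a p with h | h
  · exact choose_lucas n k h hb
  · obtain ⟨c, rfl⟩ := Nat.exists_eq_add_of_le h
    have hc : c < p := by omega
    have h0 : c.choose b = 0 := Nat.choose_eq_zero_of_lt (by omega)
    have h1 := choose_lucas (p := p) (n + 1) k hc hb
    have h2 := choose_lucas (p := p) 1 0 hc hb
    rw [show p * n + (p + c) = p * (n + 1) + c by ring, h1]
    simp only [mul_one, mul_zero, zero_add] at h2
    rw [h2, h0]
    simp

theorem sum_range_mul_digits {M : Type*} [AddCommMonoid M] (p N : ℕ) (f : ℕ → M) :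
    ∑ k ∈ range (p * N), f k = ∑ k ∈ range N, ∑ b ∈ range p, f (p * k + b) := by
  induction N with
  | zero => simp
  | succ N ih => rw [mul_add, mul_one, sum_range_add, ih, sum_range_succ]

theorem sum_range_extend {M : Type*} [AddCommMonoid M] {f : ℕ → M} {n N : ℕ}
    (hf : ∀ k, n < k → f k = 0) (hN : n < N) :
    ∑ k ∈ range (n + 1), f k = ∑ k ∈ range N, f k :=
  (eventually_constant_sum (fun k hk => hf k hk) hN).symm

/-- A sum whose summand is multiplicative over base `p` digits, up to terms that vanish, takes the
value `t ^ n` modulo `p` as soon as it does so for the digits `n < p`. -/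
theorem sum_eq_pow_of_lucas {p : ℕ} [hp : Fact p.Prime] {F : ℕ → ℕ → ZMod p} {t : ZMod p}
    (hF : ∀ n k a b, a < p → b < p → F (p * n + a) (p * k + b) = F n k * F a b)
    (h0 : ∀ n k, n < k → F n k = 0)
    (ht : ∀ a < p, ∑ k ∈ range p, F a k = t ^ a) (n : ℕ) :
    ∑ k ∈ range (n + 1), F n k = t ^ n := by
  have hp2 := hp.out.two_le
  induction n using Nat.strong_induction_on with
  | _ n ih =>
    rcases lt_or_ge n p with hn | hn
    · rw [sum_range_extend (h0 n) hn, ht n hn]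
    · have hdiv : n / p < n := Nat.div_lt_self (by omega) (by omega)
      have hlt : n % p < p := Nat.mod_lt _ (by omega)
      have hdec := Nat.div_add_mod n p
      generalize hm : n / p = m at *
      generalize ha : n % p = a at *
      subst hdec
      -- The range is padded with vanishing terms to a whole number of digit blocks.
      rw [sum_range_extend (N := p * (m + 1)) (h0 _) (by rw [mul_add]; omega),
        sum_range_mul_digits]
      have : ∀ k ∈ range (m + 1), ∑ b ∈ range p, F (p * m + a) (p * k + b) = F m k * t ^ a := by
        intro k _
        rw [← ht a hlt, mul_sum]
        exact sum_congr rfl fun b hb => hF _ _ _ _ hlt (mem_range.1 hb)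
      -- Fermat's little theorem identifies `t ^ m` with `t ^ (p * m)`.
      rw [sum_congr rfl this, ← sum_mul, ih m hdiv, pow_add, pow_mul, ZMod.pow_card]

/-- The analogue of `sum_eq_pow_of_lucas` for double sums. -/
theorem sum_sum_eq_pow_of_lucas {p : ℕ} [hp : Fact p.Prime] {F : ℕ → ℕ → ℕ → ZMod p} {t : ZMod p}
    (hF : ∀ n k l a b c, a < p → b < p → c < p →
      F (p * n + a) (p * k + b) (p * l + c) = F n k l * F a b c)
    (h0 : ∀ n k l, n < k → F n k l = 0) (h0' : ∀ n k l, n < l → F n k l = 0)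
    (ht : ∀ a < p, ∑ k ∈ range p, ∑ l ∈ range p, F a k l = t ^ a) (n : ℕ) :
    ∑ k ∈ range (n + 1), ∑ l ∈ range (n + 1), F n k l = t ^ n := by
  have hp2 := hp.out.two_le
  have ext : ∀ n N, n < N → ∑ k ∈ range (n + 1), ∑ l ∈ range (n + 1), F n k l
      = ∑ k ∈ range N, ∑ l ∈ range N, F n k l := by
    intro n N hN
    rw [sum_congr rfl fun k _ => sum_range_extend (h0' n k) hN]
    exact sum_range_extend (fun k hk => sum_eq_zero fun l _ => h0 n k l hk) hN
  induction n using Nat.strong_induction_on with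
  | _ n ih =>
    rcases lt_or_ge n p with hn | hn
    · rw [ext n p hn, ht n hn]
    · have hdiv : n / p < n := Nat.div_lt_self (by omega) (by omega)
      have hlt : n % p < p := Nat.mod_lt _ (by omega)
      have hdec := Nat.div_add_mod n p
      generalize hm : n / p = m at *
      generalize ha : n % p = a at *
      subst hdec
      rw [ext _ (p * (m + 1)) (by rw [mul_add]; omega), sum_range_mul_digits]
      have : ∀ k ∈ range (m + 1), ∑ b ∈ range p, ∑ l ∈ range (p * (m + 1)),
          F (p * m + a) (p * k + b) l = (∑ l ∈ range (m + 1), F m k l) * t ^ a := by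
        intro k _
        simp_rw [sum_range_mul_digits]
        rw [← ht a hlt, sum_comm, sum_mul]
        refine sum_congr rfl fun l _ => ?_
        rw [mul_sum]
        refine sum_congr rfl fun b hb => ?_
        rw [mul_sum]
        exact sum_congr rfl fun c hc => hF _ _ _ _ _ _ hlt (mem_range.1 hb) (mem_range.1 hc)
      rw [sum_congr rfl this, ← sum_mul, ih m hdiv, pow_add, pow_mul, ZMod.pow_card]

/-- Doubling may carry, but `2 * b < b + p`, so a carried digit is smaller than `b` and both sides
vanish. -/
theorem choose_two_mul_lucas {p : ℕ} [Fact p.Prime] (k : ℕ) {b : ℕ} (hb : b < p) :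
    ((2 * (p * k + b)).choose (p * k + b) : ZMod p)
      = (2 * k).choose k * (2 * b).choose b := by
  rw [show 2 * (p * k + b) = p * (2 * k) + 2 * b by ring]
  exact choose_lucas_carry _ _ (by omega) hb

theorem choose_two_mul_sub_lucas {p : ℕ} [Fact p.Prime] {n k a b : ℕ} (hkn : k ≤ n) (hab : b ≤ a)
    (ha : a < p) :
    ((2 * (p * n + a) - 2 * (p * k + b)).choose (p * n + a - (p * k + b)) : ZMod p)
      = (2 * n - 2 * k).choose (n - k) * (2 * a - 2 * b).choose (a - b) := by
  obtain ⟨m, rfl⟩ := Nat.exists_eq_add_of_le hkn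
  obtain ⟨c, rfl⟩ := Nat.exists_eq_add_of_le hab
  have h := choose_two_mul_lucas (p := p) m (b := c) (by omega)
  rw [show 2 * (p * (k + m) + (b + c)) - 2 * (p * k + b) = 2 * (p * m + c) by
      rw [mul_add p]; omega,
    show p * (k + m) + (b + c) - (p * k + b) = p * m + c by rw [mul_add p]; omega, h,
    show 2 * (k + m) - 2 * k = 2 * m by omega, show 2 * (b + c) - 2 * b = 2 * c by omega,
    Nat.add_sub_cancel_left, Nat.add_sub_cancel_left]

/-! ### Binomial coefficients with an integer upper argument -/

theorem chooseInt_natCast (m k : ℕ) : chooseInt (m : ℤ) k = m.choose k := by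
  simp [chooseInt]

theorem chooseInt_of_neg {m : ℤ} (hm : m < 0) (k : ℕ) : chooseInt m k = 0 := by
  simp [chooseInt, hm]

/-- Pascal's rule survives the zero convention because the lower index on the left is positive; for
lower index 0 it would break at `m = -1`. -/
theorem chooseInt_succ_succ (m : ℤ) (k : ℕ) :
    chooseInt (m + 1) (k + 1) = chooseInt m k + chooseInt m (k + 1) := by
  rcases lt_trichotomy m (-1) with h | rfl | h
  · rw [chooseInt_of_neg (by omega), chooseInt_of_neg (by omega), chooseInt_of_neg (by omega),
      add_zero]
  · simp [chooseInt]
  · obtain ⟨m, rfl⟩ := Int.eq_ofNat_of_zero_le (show 0 ≤ m by omega)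
    have : ((m : ℤ) + 1) = ((m + 1 : ℕ) : ℤ) := by push_cast; rfl
    rw [this]
    simp only [chooseInt_natCast, Nat.choose_succ_succ']
    push_cast
    rfl

theorem mul_chooseInt_sub_one (m : ℤ) (k : ℕ) :
    m * chooseInt (m - 1) k = (m - k) * chooseInt m k := by
  rcases lt_trichotomy m 0 with h | rfl | h
  · rw [chooseInt_of_neg h, chooseInt_of_neg (by omega), mul_zero, mul_zero]
  · cases k <;> simp [chooseInt]
  · obtain ⟨m, rfl⟩ : ∃ j : ℕ, m = (j + 1 : ℕ) := ⟨(m - 1).toNat, by omega⟩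
    rw [show ((m + 1 : ℕ) : ℤ) - 1 = (m : ℕ) by push_cast; ring, chooseInt_natCast,
      chooseInt_natCast]
    have h := Nat.choose_mul_succ_eq m k
    rcases le_or_gt k (m + 1) with hk | hk
    · zify [hk] at h
      push_cast
      linarith
    · rw [Nat.choose_eq_zero_of_lt hk, Nat.choose_eq_zero_of_lt (by omega)]
      simp

/-- A digit `0 ≤ a < p` does not change the sign: `p * m + a` is negative exactly when `m` is, so
the zero convention is compatible with Lucas. -/
theorem chooseInt_lucas {p : ℕ} [Fact p.Prime] (m : ℤ) (k : ℕ) {a b : ℕ} (ha : a < p)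
    (hb : b < p) :
    (chooseInt (p * m + a) (p * k + b) : ZMod p) = chooseInt m k * a.choose b := by
  rcases lt_or_ge m 0 with h | h
  · have : (p : ℤ) * m + a < 0 := by nlinarith
    rw [chooseInt_of_neg this, chooseInt_of_neg h]
    simp
  · obtain ⟨m, rfl⟩ := Int.eq_ofNat_of_zero_le h
    have := choose_lucas (p := p) m k ha hb
    rw [show (p : ℤ) * (m : ℕ) + (a : ℕ) = ((p * m + a : ℕ) : ℤ) by push_cast; rfl,
      chooseInt_natCast, chooseInt_natCast]
    exact_mod_cast this

/-! ### Halved central binomial coefficients modulo `2` -/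

/-- Half of the central binomial coefficient, with the value `0` at `0`. -/
def halfCentral (k : ℕ) : ℕ := k.centralBinom / 2

theorem halfCentral_zero : halfCentral 0 = 0 := by simp [halfCentral]

theorem choose_eq_two_mul_halfCentral {k : ℕ} (hk : 0 < k) :
    (2 * k).choose k = 2 * halfCentral k := by
  rw [halfCentral, Nat.mul_div_cancel' (Nat.two_dvd_centralBinom_of_one_le hk),
    Nat.centralBinom_eq_two_mul_choose]

/-- The two Pascal summands of a central binomial are equal, so its half is a genuine binomial
coefficient, to which Lucas applies. -/
theorem halfCentral_succ (k : ℕ) : halfCentral (k + 1) = (2 * k + 1).choose k := by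
  have h := choose_eq_two_mul_halfCentral (k := k + 1) (by omega)
  rw [show 2 * (k + 1) = 2 * k + 1 + 1 by ring, Nat.choose_succ_succ',
    Nat.choose_symm_half] at h
  omega

theorem halfCentral_two_mul (k : ℕ) : (halfCentral (2 * k) : ZMod 2) = halfCentral k := by
  cases k with
  | zero => rfl
  | succ k =>
    rw [show 2 * (k + 1) = 2 * k + 1 + 1 by ring, halfCentral_succ, halfCentral_succ,
      choose_lucas (p := 2) _ _ (by omega) (by omega)]
    simp

/-- Lucas reduces the half to a central binomial of positive index, which is even. With the doubling
rule, `halfCentral` is odd exactly at the powers of 2. -/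
theorem halfCentral_two_mul_add_one {k : ℕ} (hk : 0 < k) :
    (halfCentral (2 * k + 1) : ZMod 2) = 0 := by
  have h := choose_lucas (p := 2) (2 * k) k (a := 1) (b := 0) (by omega) (by omega)
  rw [add_zero] at h
  rw [halfCentral_succ, h, choose_eq_two_mul_halfCentral hk]
  push_cast
  rw [show (2 : ZMod 2) = 0 from rfl]
  simp

/-- Modulo `2` the halved central binomial coefficients satisfy a doubling rule for sums. -/
theorem sum_halfCentral_mul (H : ℕ → ZMod 2) {N : ℕ} (hN : 0 < N) :
    ∑ k ∈ range (2 * N), (halfCentral k : ZMod 2) * H k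
      = ∑ k ∈ range N, (halfCentral k : ZMod 2) * H (2 * k) + H 1 := by
  have h1 : (halfCentral 1 : ZMod 2) = 1 := rfl
  rw [sum_range_mul_digits]
  simp only [sum_range_succ, range_zero, sum_empty, zero_add, add_zero, halfCentral_two_mul,
    sum_add_distrib]
  congr 1
  rw [sum_eq_single_of_mem 0 (mem_range.2 hN)]
  · simp [h1]
  · intro k _ hk
    rw [halfCentral_two_mul_add_one (by omega), zero_mul]

theorem choose_add_lucas {p : ℕ} [Fact p.Prime] (n k : ℕ) {a b : ℕ} (ha : a < p) (hb : b < p) :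
    ((p * n + a + (p * k + b)).choose (p * k + b) : ZMod p)
      = (n + k).choose k * (a + b).choose b := by
  rw [show p * n + a + (p * k + b) = p * (n + k) + (a + b) by ring]
  exact choose_lucas_carry _ _ (by omega) hb

/-- A sum with Lucas behaviour at the multiples of `p` and vanishing summands elsewhere is zero
modulo `p` at all positive indices. -/
theorem sum_eq_zero_of_lucas {p : ℕ} [hp : Fact p.Prime] {F : ℕ → ℕ → ZMod p}
    (h0 : ∀ n k, n < k → F n k = 0)
    (hF : ∀ n k, F (p * n) (p * k) = F n k)
    (hF0 : ∀ n k b, 0 < b → b < p → F (p * n) (p * k + b) = 0)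
    (hn0 : ∀ n k, ¬ p ∣ n → F n k = 0) {n : ℕ} (hn : 0 < n) :
    ∑ k ∈ range (n + 1), F n k = 0 := by
  have hp2 := hp.out.two_le
  induction n using Nat.strong_induction_on with
  | _ n ih =>
    by_cases hd : p ∣ n
    · obtain ⟨m, rfl⟩ := hd
      have hm : 0 < m := Nat.pos_of_mul_pos_left hn
      rw [sum_range_extend (N := p * (m + 1)) (h0 _) (by rw [mul_add]; omega),
        sum_range_mul_digits, ← ih m (by nlinarith) hm]
      refine sum_congr rfl fun k _ => ?_
      rw [sum_eq_single_of_mem 0 (mem_range.2 (by omega))]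
      · exact hF m k
      · intro b hb hb0
        exact hF0 m k b (by omega) (mem_range.1 hb)
    · exact sum_eq_zero fun k _ => hn0 n k hd

/-- A sum whose summands collapse in pairs under halving is constant. -/
theorem sum_eq_of_halving {M : Type*} [AddCommMonoid M] {F : ℕ → ℕ → M}
    (h0 : ∀ n k, n < k → F n k = 0)
    (hF : ∀ n k a, a < 2 → F (2 * n + a) (2 * k) + F (2 * n + a) (2 * k + 1) = F n k) (n : ℕ) :
    ∑ k ∈ range (n + 1), F n k = F 0 0 := by
  induction n using Nat.strong_induction_on with
  | _ n ih =>
    rcases Nat.eq_zero_or_pos n with rfl | hn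
    · simp
    · rw [sum_range_extend (N := 2 * (n / 2 + 1)) (h0 _) (by omega), sum_range_mul_digits,
        ← ih (n / 2) (by omega)]
      refine sum_congr rfl fun k _ => ?_
      have := hF (n / 2) k (n % 2) (Nat.mod_lt _ (by norm_num))
      rw [Nat.div_add_mod] at this
      simpa [sum_range_succ] using this

/-! ### Congruence and divisibility tools -/

theorem Int.modEq_of_zmod {a b : ℤ} {N : ℕ} (h : (a : ZMod N) = b) : a ≡ b [ZMOD N] :=
  (ZMod.intCast_eq_intCast_iff _ _ _).1 h

theorem Int.modEq_natCast_mul {a b : ℤ} {m n : ℕ} (h : m.Coprime n) (hm : a ≡ b [ZMOD (m : ℤ)])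
    (hn : a ≡ b [ZMOD (n : ℤ)]) : a ≡ b [ZMOD ((m * n : ℕ) : ℤ)] := by
  rw [Nat.cast_mul]
  exact (Int.modEq_and_modEq_iff_modEq_mul (by simpa using h)).1 ⟨hm, hn⟩

theorem two_dvd_choose_two_mul {k : ℕ} (hk : 0 < k) : (2 : ℤ) ∣ ((2 * k).choose k : ℤ) := by
  rw [choose_eq_two_mul_halfCentral hk]
  push_cast
  exact dvd_mul_right _ _

/-- Absorption gives `(3k choose k) = 3 * (3k - 1 choose k - 1)`. -/
theorem three_dvd_choose_three_mul {k : ℕ} (hk : 0 < k) :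
    (3 : ℤ) ∣ ((3 * k).choose (2 * k) : ℤ) := by
  obtain ⟨j, rfl⟩ := Nat.exists_eq_succ_of_ne_zero hk.ne'
  have h := Nat.add_one_mul_choose_eq (3 * j + 2) j
  rw [Nat.choose_symm_of_eq_add (show 3 * j.succ = 2 * j.succ + j.succ by omega)]
  have : (3 * j + 2 + 1).choose (j + 1) = 3 * (3 * j + 2).choose j := by
    apply Nat.eq_of_mul_eq_mul_right (Nat.succ_pos j)
    rw [Nat.succ_eq_add_one, ← h]
    ring
  rw [show 3 * j.succ = 3 * j + 2 + 1 by rw [Nat.succ_eq_add_one]; ring, Nat.succ_eq_add_one, this]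
  exact_mod_cast dvd_mul_right _ _

/-- A sum over `range (n + 1)` is congruent to its first summand if all others vanish modulo
`d`. -/
theorem sum_modEq_first {f : ℕ → ℤ} {d : ℤ} {n : ℕ}
    (h : ∀ k, 0 < k → k ≤ n → d ∣ f k) : ∑ k ∈ range (n + 1), f k ≡ f 0 [ZMOD d] := by
  rw [sum_range_succ']
  have : d ∣ ∑ k ∈ range n, f (k + 1) :=
    dvd_sum fun k hk => h _ (by omega) (by have := mem_range.1 hk; omega)
  simpa using (Int.modEq_zero_iff_dvd.2 this).add_right (f 0)

theorem sum_modEq_zero_pow {f : ℕ → ℤ} {d t : ℤ} {n : ℕ} (hn : 0 < n) (ht : d ∣ t)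
    (h : ∀ k, k ≤ n → d ∣ f k) : ∑ k ∈ range (n + 1), f k ≡ t ^ n [ZMOD d] := by
  refine (Int.modEq_zero_iff_dvd.2 (dvd_sum fun k hk => h k ?_)).trans
    (Int.modEq_zero_iff_dvd.2 (dvd_pow ht hn.ne')).symm
  have := mem_range.1 hk
  omega

/-! ### Congruences from Fermat, Lucas and divisibility of summands -/

namespace AperyLike

theorem seq_zero (s : AperyLike) : s.seq 0 = 1 := by cases s <;> rfl

/-- Since `x ^ 3 ≡ x` modulo 6, the cubes can be replaced by the binomials themselves. -/
theorem seq_A_modEq (n : ℕ) : A.seq n ≡ 2 ^ n [ZMOD 6] := by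
  have h : ∀ x : ℤ, x ^ 3 ≡ x [ZMOD 6] := by
    intro x
    apply Int.modEq_of_zmod (N := 6)
    push_cast
    generalize (x : ZMod 6) = y
    revert y
    decide
  have hs : ∑ k ∈ range (n + 1), (n.choose k : ℤ) = 2 ^ n := by
    exact_mod_cast Nat.sum_range_choose n
  rw [← hs]
  exact Int.ModEq.sum fun k _ => h _

theorem seq_B_modEq (n : ℕ) : B.seq n ≡ 3 ^ n [ZMOD 6] := by
  refine Int.modEq_natCast_mul (m := 2) (n := 3) (by norm_num) ?_ ?_
  · refine (sum_modEq_first fun k hk _ => ?_).trans (by simp [Int.ModEq.refl])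
    exact dvd_mul_of_dvd_right (two_dvd_choose_two_mul hk) _
  · rcases Nat.eq_zero_or_pos n with rfl | hn
    · rfl
    refine sum_modEq_zero_pow hn (by norm_num) fun k _ => ?_
    -- The explicit power of 3 helps unless `n = 3 * k`; there the factor `(3k choose 2k)` takes
    -- over.
    rcases lt_trichotomy n (3 * k) with h | rfl | h
    · simp [Nat.choose_eq_zero_of_lt h]
    · exact dvd_mul_of_dvd_left
        (dvd_mul_of_dvd_right (three_dvd_choose_three_mul (by omega)) _) _
    · refine dvd_mul_of_dvd_left (dvd_mul_of_dvd_left (dvd_mul_of_dvd_left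
        (dvd_mul_of_dvd_right (dvd_pow_self _ ?_) _) _) _) _
      omega

theorem seq_C_modEq (n : ℕ) : C.seq n ≡ 3 ^ n [ZMOD 6] := by
  refine Int.modEq_natCast_mul (m := 2) (n := 3) (by norm_num) ?_ ?_
  · refine (sum_modEq_first fun k hk _ => ?_).trans ?_
    · exact dvd_mul_of_dvd_right (two_dvd_choose_two_mul hk) _
    · simpa using ((show (3 : ℤ) ≡ 1 [ZMOD 2] by decide).pow n).symm
  · apply Int.modEq_of_zmod
    simp only [seq]
    push_cast
    refine sum_eq_pow_of_lucas (p := 3) (t := 3)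
      (F := fun n k => (n.choose k : ZMod 3) ^ 2 * ((2 * k).choose k : ZMod 3)) ?_ ?_ ?_ n
    · intro n k a b ha hb
      rw [choose_lucas _ _ ha hb, choose_two_mul_lucas _ hb]
      ring
    · intro n k h
      simp [Nat.choose_eq_zero_of_lt h]
    · intro a ha
      interval_cases a <;> rfl

theorem seq_D_modEq (n : ℕ) : D.seq n ≡ 3 ^ n [ZMOD 10] := by
  have : Fact (Nat.Prime 5) := ⟨by norm_num⟩
  refine Int.modEq_natCast_mul (m := 2) (n := 5) (by norm_num) ?_ ?_
  · refine (sum_modEq_first fun k hk _ => ?_).trans ?_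
    · have h := Nat.choose_mul (n := n + k) (k := 2 * k) (s := k) (by omega)
      rw [Nat.add_sub_cancel, show 2 * k - k = k by omega] at h
      rw [show (n.choose k : ℤ) ^ 2 * ((n + k).choose k : ℤ)
        = n.choose k * ((n + k).choose (2 * k) * (2 * k).choose k) by
          rw [show ((n + k).choose (2 * k) : ℤ) * (2 * k).choose k
            = (n + k).choose k * n.choose k by exact_mod_cast h]
          ring]
      exact dvd_mul_of_dvd_right (dvd_mul_of_dvd_right (two_dvd_choose_two_mul hk) _) _
    · simpa using ((show (3 : ℤ) ≡ 1 [ZMOD 2] by decide).pow n).symm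
  · apply Int.modEq_of_zmod
    simp only [seq]
    push_cast
    refine sum_eq_pow_of_lucas (p := 5) (t := 3)
      (F := fun n k => (n.choose k : ZMod 5) ^ 2 * ((n + k).choose k : ZMod 5)) ?_ ?_ ?_ n
    · intro n k a b ha hb
      rw [choose_lucas _ _ ha hb, choose_add_lucas _ _ ha hb]
      ring
    · intro n k h
      simp [Nat.choose_eq_zero_of_lt h]
    · intro a ha
      interval_cases a <;> rfl

theorem seq_E_modEq (n : ℕ) : E.seq n ≡ 4 ^ n [ZMOD 4] := by
  rcases Nat.eq_zero_or_pos n with rfl | hn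
  · rfl
  refine sum_modEq_zero_pow hn (by norm_num) fun k _ => ?_
  rcases lt_trichotomy n (2 * k) with h | rfl | h
  · simp [Nat.choose_eq_zero_of_lt h]
  · exact dvd_mul_of_dvd_right (pow_dvd_pow_of_dvd (two_dvd_choose_two_mul (k := k) (by omega)) 2) _
  · refine dvd_mul_of_dvd_left (dvd_mul_of_dvd_left (dvd_pow_self _ ?_) _) _
    omega

/-- F is a signed binomial transform of A, and A is `2 ^ k` modulo 6, so the sum becomes `(8 - 2) ^
n`. -/
theorem seq_F_modEq (n : ℕ) : F.seq n ≡ 6 ^ n [ZMOD 6] := by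
  have h : (6 : ℤ) ^ n
      = ∑ k ∈ range (n + 1), (-1) ^ k * 8 ^ (n - k) * (n.choose k : ℤ) * 2 ^ k := by
    rw [show (6 : ℤ) = -2 + 8 by norm_num, add_pow]
    refine sum_congr rfl fun k _ => ?_
    rw [neg_pow (2 : ℤ)]
    ring
  rw [h]
  exact Int.ModEq.sum fun k _ => (seq_A_modEq k).mul_left _

theorem seq_delta_modEq (n : ℕ) : delta.seq n ≡ 3 ^ n [ZMOD 24] := by
  refine Int.modEq_natCast_mul (m := 8) (n := 3) (by norm_num) ?_ ?_
  · refine (sum_modEq_first fun k hk _ => ?_).trans (by simp [Int.ModEq.refl])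
    rcases lt_or_ge n (3 * k) with h | h
    · simp [Nat.choose_eq_zero_of_lt h]
    have h1 := Nat.choose_mul (n := n + k) (k := 4 * k) (s := k) (by omega)
    -- Regrouping the multinomial factors exposes three even central binomials, of indices `2 * k`,
    -- `k` and `k`, hence the factor 8.
    have h2 := Nat.choose_mul (n := 4 * k) (k := 3 * k) (s := 2 * k) (by omega)
    have h3 := Nat.choose_symm_of_eq_add (show 4 * k = 3 * k + k by ring)
    rw [Nat.add_sub_cancel, show 4 * k - k = 3 * k by omega, ← h3] at h1
    rw [show 4 * k - 2 * k = 2 * k by omega, show 3 * k - 2 * k = k by omega,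
      show 4 * k = 2 * (2 * k) by ring] at h2
    rw [show 4 * k = 2 * (2 * k) by ring] at h1
    have h1' : ((n + k).choose (2 * (2 * k)) : ℤ) * (2 * (2 * k)).choose (3 * k)
      = (n + k).choose k * n.choose (3 * k) := by exact_mod_cast h1
    have h2' : ((2 * (2 * k)).choose (3 * k) : ℤ) * (3 * k).choose (2 * k)
      = (2 * (2 * k)).choose (2 * k) * (2 * k).choose k := by exact_mod_cast h2
    have hd := mul_dvd_mul (two_dvd_choose_two_mul (k := 2 * k) (by omega))
      (mul_dvd_mul (two_dvd_choose_two_mul hk) (two_dvd_choose_two_mul hk))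
    rw [show (-1) ^ k * 3 ^ (n - 3 * k) * (n.choose (3 * k) : ℤ) * ((n + k).choose k : ℤ)
        * ((3 * k).choose (2 * k) : ℤ) * ((2 * k).choose k : ℤ)
        = (-1) ^ k * 3 ^ (n - 3 * k) * (n + k).choose (2 * (2 * k)) *
          ((2 * (2 * k)).choose (2 * k) * ((2 * k).choose k * (2 * k).choose k)) by
      linear_combination (-(-1) ^ k * 3 ^ (n - 3 * k) * (3 * k).choose (2 * k)
        * (2 * k).choose k : ℤ) * h1' + ((-1) ^ k * 3 ^ (n - 3 * k) * (n + k).choose (2 * (2 * k))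
        * (2 * k).choose k : ℤ) * h2']
    exact dvd_mul_of_dvd_right hd _
  · rcases Nat.eq_zero_or_pos n with rfl | hn
    · rfl
    refine sum_modEq_zero_pow hn (by norm_num) fun k _ => ?_
    rcases lt_trichotomy n (3 * k) with h | rfl | h
    · simp [Nat.choose_eq_zero_of_lt h]
    · exact dvd_mul_of_dvd_left
        (dvd_mul_of_dvd_right (three_dvd_choose_three_mul (by omega)) _) _
    · refine dvd_mul_of_dvd_left (dvd_mul_of_dvd_left (dvd_mul_of_dvd_left (dvd_mul_of_dvd_left
        (dvd_mul_of_dvd_right (dvd_pow_self _ ?_) _) _) _) _) _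
      omega

theorem seq_s10_modEq (n : ℕ) : s10.seq n ≡ 2 ^ n [ZMOD 2] := by
  have h : ∀ x : ℤ, x ^ 4 ≡ x [ZMOD 2] := by
    intro x
    apply Int.modEq_of_zmod (N := 2)
    push_cast
    generalize (x : ZMod 2) = y
    revert y
    decide
  have hs : ∑ k ∈ range (n + 1), (n.choose k : ℤ) = 2 ^ n := by
    exact_mod_cast Nat.sum_range_choose n
  rw [← hs]
  exact Int.ModEq.sum fun k _ => h _

theorem seq_alpha_modEq (n : ℕ) : alpha.seq n ≡ 4 ^ n [ZMOD 12] := by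
  refine Int.modEq_natCast_mul (m := 4) (n := 3) (by norm_num) ?_ ?_
  · rcases Nat.eq_zero_or_pos n with rfl | hn
    · rfl
    have key : ∀ k, 0 < k → (4 : ℤ) ∣ ((2 * k).choose k : ℤ) + (2 * k).choose k := by
      intro k hk
      rw [← two_mul]
      exact mul_dvd_mul (dvd_refl 2) (two_dvd_choose_two_mul hk)
    obtain ⟨m, rfl⟩ := Nat.exists_eq_succ_of_ne_zero hn.ne'
    refine Int.ModEq.trans ?_ (Int.modEq_zero_iff_dvd.2
      (dvd_pow_self (4 : ℤ) (Nat.succ_ne_zero m))).symm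
    apply Int.modEq_zero_iff_dvd.2
    simp only [seq]
    -- Interior terms contain two even central binomials. The two end terms are equal and only known
    -- to be even, so they are paired to gain the second factor 2.
    rw [sum_range_succ, sum_range_succ', add_assoc]
    refine dvd_add (dvd_sum fun k hk => ?_) ?_
    · have hk' := mem_range.1 hk
      rw [mul_assoc, ← Nat.mul_sub]
      exact dvd_mul_of_dvd_right (mul_dvd_mul (two_dvd_choose_two_mul (by omega))
        (two_dvd_choose_two_mul (by omega))) _
    · simpa using key (m + 1) (by omega)
  · apply Int.modEq_of_zmod
    simp only [seq]
    push_cast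
    refine sum_eq_pow_of_lucas (p := 3) (t := 4)
      (F := fun n k => (n.choose k : ZMod 3) ^ 2 * ((2 * k).choose k : ZMod 3)
        * ((2 * n - 2 * k).choose (n - k) : ZMod 3)) ?_ ?_ ?_ n
    · intro n k a b ha hb
      rw [choose_lucas _ _ ha hb, choose_two_mul_lucas _ hb]
      rcases lt_or_ge n k with h | h
      · simp [Nat.choose_eq_zero_of_lt h]
      rcases lt_or_ge a b with h' | h'
      · simp [Nat.choose_eq_zero_of_lt h']
      rw [choose_two_mul_sub_lucas h h' ha]
      ring
    · intro n k h
      simp [Nat.choose_eq_zero_of_lt h]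
    · intro a ha
      interval_cases a <;> rfl

theorem seq_zeta_modEq (n : ℕ) : zeta.seq n ≡ 3 ^ n [ZMOD 6] := by
  have lucas : ∀ p : ℕ, Fact p.Prime → ∀ n k l a b c, a < p → b < p → c < p →
      (((p * n + a).choose (p * k + b) : ZMod p) ^ 2 * ((p * n + a).choose (p * l + c) : ZMod p)
        * ((p * k + b).choose (p * l + c) : ZMod p)
        * ((p * k + b + (p * l + c)).choose (p * n + a) : ZMod p))
      = ((n.choose k : ZMod p) ^ 2 * (n.choose l : ZMod p) * (k.choose l : ZMod p)
        * ((k + l).choose n : ZMod p))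
        * ((a.choose b : ZMod p) ^ 2 * (a.choose c : ZMod p) * (b.choose c : ZMod p)
        * ((b + c).choose a : ZMod p)) := by
    intro p hp n k l a b c ha hb hc
    rw [choose_lucas _ _ ha hb, choose_lucas _ _ ha hc, choose_lucas _ _ hb hc]
    -- With `b ≤ a` the digit sum satisfies `b + c < a + p`, so the carry in `k + l` is harmless;
    -- for `b > a` both sides are zero.
    rcases lt_or_ge a b with h | h
    · simp [Nat.choose_eq_zero_of_lt h]
    rw [show p * k + b + (p * l + c) = p * (k + l) + (b + c) by ring,
      choose_lucas_carry (k + l) n (a := b + c) (b := a) (by omega) ha]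
    ring
  have mod_p : ∀ p : ℕ, Fact p.Prime →
      (∀ a < p, ∑ b ∈ range p, ∑ c ∈ range p, ((a.choose b : ZMod p) ^ 2 * (a.choose c : ZMod p)
        * (b.choose c : ZMod p) * ((b + c).choose a : ZMod p)) = 3 ^ a) →
      zeta.seq n ≡ 3 ^ n [ZMOD (p : ℤ)] := by
    intro p hp hb
    apply Int.modEq_of_zmod
    simp only [seq]
    push_cast
    refine sum_sum_eq_pow_of_lucas (t := 3) (F := fun n k l => ((n.choose k : ZMod p) ^ 2
      * (n.choose l : ZMod p) * (k.choose l : ZMod p) * ((k + l).choose n : ZMod p)))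
      (lucas p hp) ?_ ?_ hb n
    · intro n k l h
      simp [Nat.choose_eq_zero_of_lt h]
    · intro n k l h
      simp [Nat.choose_eq_zero_of_lt h]
  refine Int.modEq_natCast_mul (m := 2) (n := 3) (by norm_num)
    (mod_p 2 inferInstance ?_) (mod_p 3 inferInstance ?_)
  · intro a ha
    interval_cases a <;> rfl
  · intro a ha
    interval_cases a <;> rfl

end AperyLike

/-! ### Congruences modulo 8 via parity of halved central binomials -/

theorem choose_mul_choose_two_mul {n k : ℕ} (h : k ≤ n) :
    (n.choose k : ℤ) * (2 * k).choose n = (2 * k).choose k * k.choose (n - k) := by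
  have := Nat.choose_mul (n := 2 * k) (k := n) (s := k) h
  rw [show 2 * k - k = k by omega] at this
  rw [mul_comm]
  exact_mod_cast this

theorem choose_mul_choose_add (n k : ℕ) :
    (n.choose k : ℤ) * (n + k).choose k = (2 * k).choose k * (n + k).choose (2 * k) := by
  have h := Nat.choose_mul (n := n + k) (k := 2 * k) (s := k) (by omega)
  rw [Nat.add_sub_cancel, show 2 * k - k = k by omega] at h
  rw [mul_comm, mul_comm ((2 * k).choose k : ℤ)]
  exact_mod_cast h.symm

/-- If the summands are `4 * w k` with `∑ w` congruent to `c` modulo `2`, the sum is congruent to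
`4 * c` modulo `8`. -/
theorem sum_modEq_eight {ι : Type*} {s : Finset ι} {f w : ι → ℤ} {c : ℤ}
    (hf : ∀ k ∈ s, f k = 4 * w k) (hw : ((∑ k ∈ s, w k : ℤ) : ZMod 2) = c) :
    ∑ k ∈ s, f k ≡ 4 * c [ZMOD 8] := by
  rw [sum_congr rfl hf, ← mul_sum]
  exact (Int.modEq_of_zmod (N := 2) hw).mul_left' (c := 4)

theorem zmod_two_sq (x : ZMod 2) : x ^ 2 = x := by
  revert x
  decide

theorem zmod_two_two : (2 : ZMod 2) = 0 := rfl

theorem choose_two_mul_even (n k : ℕ) : ((2 * n).choose (2 * k) : ZMod 2) = n.choose k := by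
  simpa using choose_lucas (p := 2) n k (a := 0) (b := 0) (by omega) (by omega)

theorem choose_two_mul_add_one_even (n k : ℕ) :
    ((2 * n + 1).choose (2 * k) : ZMod 2) = n.choose k := by
  simpa using choose_lucas (p := 2) n k (a := 1) (b := 0) (by omega) (by omega)

theorem choose_two_mul_odd (n k : ℕ) :
    ((2 * n).choose (2 * k + 1) : ZMod 2) = 0 := by
  simpa using choose_lucas (p := 2) n k (a := 0) (b := 1) (by omega) (by omega)

theorem choose_two_mul_add_one_odd (n k : ℕ) :
    ((2 * n + 1).choose (2 * k + 1) : ZMod 2) = n.choose k := by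
  simpa using choose_lucas (p := 2) n k (a := 1) (b := 1) (by omega) (by omega)

/-- The sums of `halfCentral k * choose k (n - k) * h n k` are even for `n ≥ 2` if `h` is
invariant under doubling and `h 2 1 = h 1 1`. -/
theorem sum_halfCentral_mul_choose_sub {h : ℕ → ℕ → ZMod 2}
    (hh : ∀ n k, h (2 * n) (2 * k) = h n k) (h1 : h 2 1 = h 1 1) {n : ℕ} (hn : 2 ≤ n) :
    ∑ k ∈ range (n + 1), (halfCentral k : ZMod 2)
      * ((if k ≤ n then k.choose (n - k) else 0 : ℕ) * h n k) = 0 := by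
  induction n using Nat.strong_induction_on with
  | _ n ih =>
    -- The guard `k ≤ n` matters: truncated subtraction would make `k.choose (n - k)` equal to 1 for
    -- `k > n`.
    have hz : ∀ n k, n < k → (halfCentral k : ZMod 2)
        * ((if k ≤ n then k.choose (n - k) else 0 : ℕ) * h n k) = 0 := by
      intro n k hk
      simp [hk.not_ge]
    rw [sum_range_extend (N := 2 * (n / 2 + 1)) (hz n) (by omega), sum_halfCentral_mul _ (by omega)]
    obtain ⟨m, rfl | rfl⟩ : ∃ m, n = 2 * m ∨ n = 2 * m + 1 := ⟨n / 2, by omega⟩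
    · have he : ∀ k ∈ range (m + 1), (halfCentral k : ZMod 2)
          * ((if 2 * k ≤ 2 * m then (2 * k).choose (2 * m - 2 * k) else 0 : ℕ) * h (2 * m) (2 * k))
          = (halfCentral k : ZMod 2) * ((if k ≤ m then k.choose (m - k) else 0 : ℕ) * h m k) := by
        intro k hk
        have hk' : k ≤ m := by have := mem_range.1 hk; omega
        rw [if_pos hk', if_pos (by omega), hh, ← Nat.mul_sub, choose_two_mul_even]
      rw [show 2 * m / 2 = m by omega, sum_congr rfl he]
      rcases Nat.lt_or_ge m 2 with hm | hm
      -- For `n = 2` the boundary term `H 1` survives and cancels the `k = 1` term; this is where `h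
      -- 2 1 = h 1 1` enters.
      · obtain rfl : m = 1 := by omega
        have e1 : (halfCentral 1 : ZMod 2) = 1 := rfl
        simp only [sum_range_succ, range_zero, sum_empty, halfCentral_zero, e1]
        simp [h1, CharTwo.add_self_eq_zero]
      · rw [ih m (by omega) hm, if_pos (by omega), Nat.choose_eq_zero_of_lt (by omega)]
        simp
    · rw [sum_eq_zero, if_pos (by omega), Nat.choose_eq_zero_of_lt (by omega)]
      · simp
      · intro k hk
        have hk' := mem_range.1 hk
        rw [if_pos (by omega), show 2 * m + 1 - 2 * k = 2 * (m - k) + 1 by omega,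
          choose_two_mul_odd]
        simp

/-- Writing `S` for the sum, halving gives `S (2m) = S m + m` and `S (2m + 1) = S m + m + 1` modulo
2. -/
theorem sum_halfCentral_mul_choose_add (n : ℕ) :
    ∑ k ∈ range (n + 1), (halfCentral k : ZMod 2) * (n + k).choose (2 * k) = n := by
  induction n using Nat.strong_induction_on with
  | _ n ih =>
    have hz : ∀ n k, n < k → (halfCentral k : ZMod 2) * (n + k).choose (2 * k) = 0 := by
      intro n k hk
      simp [Nat.choose_eq_zero_of_lt (show n + k < 2 * k by omega)]
    rcases Nat.eq_zero_or_pos n with rfl | hn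
    · rfl
    rw [sum_range_extend (N := 2 * (n / 2 + 1)) (hz n) (by omega),
      sum_halfCentral_mul (fun k => ((n + k).choose (2 * k) : ZMod 2)) (by omega)]
    obtain ⟨m, rfl | rfl⟩ : ∃ m, n = 2 * m ∨ n = 2 * m + 1 := ⟨n / 2, by omega⟩
    · simp only [← mul_add, choose_two_mul_even]
      rw [show 2 * m / 2 = m by omega, ih m (by omega), choose_two_mul_add_one_even]
      push_cast
      rw [Nat.choose_one_right, zmod_two_two, CharTwo.add_self_eq_zero]
      simp
    · have e : ∀ k, 2 * m + 1 + 2 * k = 2 * (m + k) + 1 := fun k => by ring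
      simp only [e, choose_two_mul_add_one_even]
      rw [show (2 * m + 1) / 2 = m by omega, ih m (by omega),
        show 2 * m + 1 + 1 = 2 * (m + 1) by ring, choose_two_mul_even]
      push_cast
      rw [Nat.choose_one_right, zmod_two_two]
      push_cast
      rw [← add_assoc, CharTwo.add_self_eq_zero]
      simp

namespace AperyLike

theorem seq_gamma_modEq (n : ℕ) : gamma.seq n ≡ 5 ^ n [ZMOD 24] := by
  refine Int.modEq_natCast_mul (m := 8) (n := 3) (by norm_num) ?_ ?_
  · have hs : gamma.seq n = 1 + ∑ k ∈ range n,
        (((n.choose (k + 1) : ℤ) ^ 2 * ((n + (k + 1)).choose (k + 1) : ℤ) ^ 2)) := by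
      simp only [seq]
      rw [sum_range_succ', add_comm]
      simp
    have h8 : ∑ k ∈ range n,
        (((n.choose (k + 1) : ℤ) ^ 2 * ((n + (k + 1)).choose (k + 1) : ℤ) ^ 2))
          ≡ 4 * n [ZMOD 8] := by
      refine sum_modEq_eight
        (w := fun k => ((halfCentral (k + 1) : ℤ) * (n + (k + 1)).choose (2 * (k + 1))) ^ 2) ?_ ?_
      · intro k _
        rw [← mul_pow, choose_mul_choose_add, choose_eq_two_mul_halfCentral (Nat.succ_pos k)]
        push_cast
        ring
      · push_cast
        simp only [zmod_two_sq]
        have := sum_halfCentral_mul_choose_add n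
        rw [sum_range_succ', halfCentral_zero] at this
        simpa using this
    rw [hs]
    -- It remains to see `1 + 4 * n ≡ 5 ^ n` modulo 8.
    refine (h8.add_left 1).trans ?_
    clear hs h8
    induction n with
    | zero => rfl
    | succ n ih =>
      rw [pow_succ]
      refine Int.ModEq.trans ?_ (ih.mul_right 5)
      apply Int.modEq_iff_dvd.2
      push_cast
      exact ⟨2 * n, by ring⟩
  · apply Int.modEq_of_zmod
    simp only [seq]
    push_cast
    refine sum_eq_pow_of_lucas (p := 3) (t := 5)
      (F := fun n k => (n.choose k : ZMod 3) ^ 2 * ((n + k).choose k : ZMod 3) ^ 2) ?_ ?_ ?_ n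
    · intro n k a b ha hb
      rw [choose_lucas _ _ ha hb, choose_add_lucas _ _ ha hb]
      ring
    · intro n k h
      simp [Nat.choose_eq_zero_of_lt h]
    · intro a ha
      interval_cases a <;> rfl

theorem four_pow_modEq_zero {n : ℕ} (hn : 2 ≤ n) : (4 : ℤ) ^ n ≡ 4 * 0 [ZMOD 8] := by
  rw [mul_zero]
  exact Int.modEq_zero_iff_dvd.2 ((show (8 : ℤ) ∣ 4 ^ 2 by norm_num).trans (pow_dvd_pow 4 hn))

theorem seq_epsilon_modEq (n : ℕ) : epsilon.seq n ≡ 4 ^ n [ZMOD 24] := by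
  refine Int.modEq_natCast_mul (m := 8) (n := 3) (by norm_num) ?_ ?_
  · rcases lt_or_ge n 2 with hn | hn
    · interval_cases n <;> decide
    refine Int.ModEq.trans ?_ (four_pow_modEq_zero hn).symm
    refine sum_modEq_eight
      (w := fun k => ((halfCentral k : ℤ) * (if k ≤ n then k.choose (n - k) else 0 : ℕ)) ^ 2) ?_ ?_
    · intro k hk
      have hk' : k ≤ n := by have := mem_range.1 hk; omega
      rw [← mul_pow, choose_mul_choose_two_mul hk', if_pos hk']
      rcases Nat.eq_zero_or_pos k with rfl | hk0
      · simp [Nat.choose_eq_zero_of_lt (show 0 < n by omega)]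
      rw [choose_eq_two_mul_halfCentral hk0]
      push_cast
      ring
    · have := sum_halfCentral_mul_choose_sub (h := fun _ _ => 1) (fun _ _ => rfl) rfl hn
      rw [Int.cast_sum, Int.cast_zero, ← this]
      refine sum_congr rfl fun k _ => ?_
      rw [Int.cast_pow, zmod_two_sq, mul_one]
      push_cast
      rfl
  · apply Int.modEq_of_zmod
    simp only [seq]
    push_cast
    refine sum_eq_pow_of_lucas (p := 3) (t := 4)
      (F := fun n k => (n.choose k : ZMod 3) ^ 2 * ((2 * k).choose n : ZMod 3) ^ 2) ?_ ?_ ?_ n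
    · intro n k a b ha hb
      rw [choose_lucas _ _ ha hb]
      rcases lt_or_ge a b with h | h
      · simp [Nat.choose_eq_zero_of_lt h]
      rw [show 2 * (3 * k + b) = 3 * (2 * k) + 2 * b by ring,
        choose_lucas_carry (2 * k) n (a := 2 * b) (b := a) (by omega) ha]
      ring
    · intro n k h
      simp [Nat.choose_eq_zero_of_lt h]
    · intro a ha
      interval_cases a <;> rfl

theorem seq_s7_modEq (n : ℕ) : s7.seq n ≡ 4 ^ n [ZMOD 8] := by
  rcases lt_or_ge n 2 with hn | hn
  · interval_cases n <;> decide
  refine Int.ModEq.trans ?_ (four_pow_modEq_zero hn).symm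
  refine sum_modEq_eight
    (w := fun k => (halfCentral k : ℤ) ^ 2 * ((if k ≤ n then k.choose (n - k) else 0 : ℕ)
      * (n + k).choose (2 * k))) ?_ ?_
  · intro k hk
    have hk' : k ≤ n := by have := mem_range.1 hk; omega
    rw [if_pos hk', show (n.choose k : ℤ) ^ 2 * ((n + k).choose k : ℤ) * ((2 * k).choose n : ℤ)
      = (n.choose k * ((2 * k).choose n)) * (n.choose k * (n + k).choose k) by ring,
      choose_mul_choose_two_mul hk', choose_mul_choose_add]
    rcases Nat.eq_zero_or_pos k with rfl | hk0
    · simp [Nat.choose_eq_zero_of_lt (show 0 < n by omega)]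
    rw [choose_eq_two_mul_halfCentral hk0]
    push_cast
    ring
  · have := sum_halfCentral_mul_choose_sub (h := fun n k => ((n + k).choose (2 * k) : ZMod 2))
      (fun n k => by rw [← mul_add, choose_two_mul_even]) rfl hn
    rw [Int.cast_sum, Int.cast_zero, ← this]
    refine sum_congr rfl fun k _ => ?_
    rw [Int.cast_mul, Int.cast_pow, zmod_two_sq]
    push_cast
    rfl

end AperyLike

/-! ### The sequences `eta` and `s18`: absorption and descent -/

/-- By the absorption identity, `(m - 1).choose r + m.choose r` is divisible by a prime `p` if
`p` does not divide `m` and `2 * m` is congruent to `r` modulo `p`. -/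
theorem chooseInt_add_eq_zero {p : ℕ} [Fact p.Prime] {m : ℤ} {r : ℕ}
    (hm : (m : ZMod p) ≠ 0) (hr : (2 * m : ZMod p) = r) :
    (chooseInt (m - 1) r + chooseInt m r : ZMod p) = 0 := by
  have h := congrArg (Int.cast : ℤ → ZMod p) (mul_chooseInt_sub_one m r)
  push_cast at h
  rw [← hr] at h
  have : (m : ZMod p) * (chooseInt (m - 1) r + chooseInt m r) = 0 := by
    rw [mul_add, h]
    ring
  exact (mul_eq_zero.1 this).resolve_left hm

/-- The sum of two consecutive binomial coefficients with multiples of `p` as arguments. -/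
theorem chooseInt_sub_one_add_lucas {p : ℕ} [hp : Fact p.Prime] (m : ℤ) (r : ℕ) :
    (chooseInt (p * m - 1) (p * r) + chooseInt (p * m) (p * r) : ZMod p)
      = chooseInt (m - 1) r + chooseInt m r := by
  have hp0 := hp.out.pos
  have h1 := chooseInt_lucas (p := p) m r hp0 hp0
  -- Here `p * m - 1 = p * (m - 1) + (p - 1)`, and the last digit `p - 1` stands over 0.
  have h2 := chooseInt_lucas (p := p) (m - 1) r (a := p - 1) (by omega) hp0
  rw [Nat.cast_sub hp0, show (p : ℤ) * (m - 1) + ((p : ℤ) - (1 : ℕ)) = p * m - 1 by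
    push_cast; ring] at h2
  simp only [Nat.cast_zero, add_zero, Nat.choose_zero_right, Nat.cast_one, mul_one] at h1 h2
  rw [h1, h2]

theorem choose_mul_mul_add_eq_zero {p : ℕ} [hp : Fact p.Prime] (n k : ℕ) {b : ℕ} (hb0 : 0 < b)
    (hb : b < p) : ((p * n).choose (p * k + b) : ZMod p) = 0 := by
  have h := choose_lucas (p := p) n k hp.out.pos hb
  rwa [add_zero, Nat.choose_eq_zero_of_lt hb0, Nat.cast_zero, mul_zero] at h

theorem choose_mul_mul {p : ℕ} [hp : Fact p.Prime] (n k : ℕ) :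
    ((p * n).choose (p * k) : ZMod p) = n.choose k := by
  simpa using choose_lucas (p := p) n k hp.out.pos hp.out.pos

theorem neg_one_pow_mul_odd {R : Type*} [CommRing R] {p : ℕ} (hp : Odd p) (k : ℕ) :
    (-1 : R) ^ (p * k) = (-1) ^ k := by
  rw [pow_mul, hp.neg_one_pow]

namespace AperyLike

theorem seq_eta_modEq (n : ℕ) : eta.seq n ≡ 5 ^ n [ZMOD 10] := by
  have h4 : (4 : ZMod 5) ≠ 0 := by decide
  have : Fact (Nat.Prime 5) := ⟨by norm_num⟩
  refine Int.modEq_natCast_mul (m := 2) (n := 5) (by norm_num) ?_ ?_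
  · apply Int.modEq_of_zmod
    simp only [seq]
    push_cast
    have h5 : (5 : ZMod 2) = 1 := rfl
    have hneg : (-1 : ZMod 2) = 1 := rfl
    simp only [hneg, h5, one_pow, one_mul]
    refine (sum_eq_of_halving (F := fun n k => (n.choose k : ZMod 2) ^ 3
      * ((chooseInt (4 * n - 5 * k - 1) (3 * n) : ZMod 2) + chooseInt (4 * n - 5 * k) (3 * n)))
      ?_ ?_ n).trans (by decide)
    · intro n k h
      simp [Nat.choose_eq_zero_of_lt h]
    · intro n k a ha
      interval_cases a
      · rw [add_zero, choose_two_mul_even, choose_two_mul_odd]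
        have := chooseInt_sub_one_add_lucas (p := 2) (4 * n - 5 * k) (3 * n)
        rw [← this]
        push_cast
        ring_nf
      · rw [choose_two_mul_add_one_even, choose_two_mul_add_one_odd, ← mul_add]
        congr 1
        have l0 : ∀ (m : ℤ) (r : ℕ), (chooseInt (2 * m) (2 * r + 1) : ZMod 2) = 0 := fun m r => by
          simpa using chooseInt_lucas (p := 2) m r (a := 0) (b := 1) (by omega) (by omega)
        have l1 : ∀ (m : ℤ) (r : ℕ), (chooseInt (2 * m + 1) (2 * r + 1) : ZMod 2)
            = chooseInt m r := fun m r => by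
          simpa using chooseInt_lucas (p := 2) m r (a := 1) (b := 1) (by omega) (by omega)
        push_cast
        rw [show 3 * (2 * n + 1) = 2 * (3 * n + 1) + 1 by ring,
          show 4 * (2 * (n : ℤ) + 1) - 5 * (2 * k) = 2 * (4 * n - 5 * k + 2) by ring,
          show 2 * (4 * (n : ℤ) - 5 * k + 2) - 1 = 2 * (4 * n - 5 * k + 1) + 1 by ring,
          show 4 * (2 * (n : ℤ) + 1) - 5 * (2 * k + 1) - 1 = 2 * (4 * n - 5 * k - 1) by ring,
          show 4 * (2 * (n : ℤ) + 1) - 5 * (2 * k + 1) = 2 * (4 * n - 5 * k - 1) + 1 by ring,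
          -- One binomial survives in each of the paired summands. With `y = 4n - 5k - 1` they are
          -- `(y + 2 choose 3n + 1)` and `(y choose 3n + 1)`; Pascal applied twice to the first
          -- recovers the summand at `(n, k)` plus a doubled term.
          l0, l0, l1, l1, chooseInt_succ_succ]
        have := chooseInt_succ_succ (4 * (n : ℤ) - 5 * k - 1) (3 * n)
        rw [sub_add_cancel] at this
        rw [this]
        push_cast
        linear_combination (chooseInt (4 * (n : ℤ) - 5 * k - 1) (3 * n + 1) : ZMod 2) * zmod_two_two
  · rcases Nat.eq_zero_or_pos n with rfl | hn
    · rfl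
    apply Int.modEq_of_zmod
    simp only [seq]
    push_cast
    have h5 : (5 : ZMod 5) = 0 := rfl
    rw [h5, zero_pow hn.ne']
    refine sum_eq_zero_of_lucas (p := 5) (F := fun n k => (-1) ^ k * (n.choose k : ZMod 5) ^ 3
      * ((chooseInt (4 * n - 5 * k - 1) (3 * n) : ZMod 5) + chooseInt (4 * n - 5 * k) (3 * n)))
      ?_ ?_ ?_ ?_ hn
    · intro n k h
      simp [Nat.choose_eq_zero_of_lt h]
    · intro n k
      rw [choose_mul_mul, neg_one_pow_mul_odd (by decide)]
      have := chooseInt_sub_one_add_lucas (p := 5) (4 * n - 5 * k) (3 * n)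
      rw [← this]
      push_cast
      rw [show 3 * (5 * n) = 5 * (3 * n) by ring,
        show 4 * (5 * (n : ℤ)) - 5 * (5 * k) = 5 * (4 * n - 5 * k) by ring]
    · intro n k b hb0 hb
      rw [choose_mul_mul_add_eq_zero _ _ hb0 hb]
      ring
    · intro n k hd
      have hn : (n : ZMod 5) ≠ 0 := fun h => hd ((ZMod.natCast_eq_zero_iff _ _).1 h)
      -- For `m = 4n - 5k` one has `2m ≡ 3n` and `m ≡ 4n ≠ 0` modulo 5, as absorption requires.
      rw [chooseInt_add_eq_zero, mul_zero]
      · push_cast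
        rw [h5, zero_mul, sub_zero]
        exact mul_ne_zero h4 hn
      · push_cast
        linear_combination (n - 2 * k : ZMod 5) * h5

theorem seq_s18_modEq (n : ℕ) : s18.seq n ≡ 6 ^ n [ZMOD 6] := by
  rcases Nat.eq_zero_or_pos n with rfl | hn
  · rfl
  refine Int.modEq_natCast_mul (m := 2) (n := 3) (by norm_num) ?_ ?_
  · refine sum_modEq_zero_pow hn (by norm_num) fun k hk => ?_
    refine dvd_mul_of_dvd_left ?_ _
    rcases Nat.eq_zero_or_pos k with rfl | hk0
    · exact dvd_mul_of_dvd_right (by simpa using two_dvd_choose_two_mul hn) _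
    · exact dvd_mul_of_dvd_left (dvd_mul_of_dvd_right (two_dvd_choose_two_mul hk0) _) _
  · apply Int.modEq_of_zmod
    simp only [seq]
    push_cast
    have h3 : (3 : ZMod 3) = 0 := rfl
    have h6 : (6 : ZMod 3) = 0 := rfl
    rw [h6, zero_pow hn.ne']
    refine sum_eq_zero_of_lucas (p := 3) (F := fun n k => (-1) ^ k * (n.choose k : ZMod 3)
      * ((2 * k).choose k : ZMod 3) * ((2 * n - 2 * k).choose (n - k) : ZMod 3)
      * ((chooseInt (2 * n - 3 * k - 1) n : ZMod 3) + chooseInt (2 * n - 3 * k) n))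
      ?_ ?_ ?_ ?_ hn
    · intro n k h
      simp [Nat.choose_eq_zero_of_lt h]
    · intro n k
      rw [choose_mul_mul, neg_one_pow_mul_odd (by decide)]
      rcases lt_or_ge n k with h | h
      · simp [Nat.choose_eq_zero_of_lt h]
      have h1 := chooseInt_sub_one_add_lucas (p := 3) (2 * n - 3 * k) n
      have h2 := choose_two_mul_lucas (p := 3) k (b := 0) (by omega)
      have h4 := choose_two_mul_sub_lucas (p := 3) h (le_refl 0) (by omega)
      simp only [add_zero, mul_zero, Nat.choose_self, Nat.cast_one, mul_one, Nat.sub_self] at h2 h4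
      rw [← h1, h2, h4]
      push_cast
      rw [show 2 * (3 * (n : ℤ)) - 3 * (3 * k) = 3 * (2 * n - 3 * k) by ring]
    · intro n k b hb0 hb
      rw [choose_mul_mul_add_eq_zero _ _ hb0 hb]
      ring
    · intro n k hd
      have hn : (n : ZMod 3) ≠ 0 := fun h => hd ((ZMod.natCast_eq_zero_iff _ _).1 h)
      -- For `m = 2n - 3k` one has `2m ≡ n` and `m ≡ 2n ≠ 0` modulo 3.
      rw [chooseInt_add_eq_zero, mul_zero]
      · push_cast
        rw [h3, zero_mul, sub_zero]
        exact mul_ne_zero (show (2 : ZMod 3) ≠ 0 by decide) hn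
      · push_cast
        linear_combination (n - 2 * k : ZMod 3) * h3

theorem seq_modEq (s : AperyLike) (n : ℕ) :
    s.seq n ≡ s.tableFirstTerm ^ n [ZMOD (s.tableModulus : ℤ)] := by
  cases s
  · exact seq_A_modEq n
  · exact seq_B_modEq n
  · exact seq_C_modEq n
  · exact seq_D_modEq n
  · exact seq_E_modEq n
  · exact seq_F_modEq n
  · exact seq_delta_modEq n
  · exact seq_eta_modEq n
  · exact seq_alpha_modEq n
  · exact seq_epsilon_modEq n
  · exact seq_zeta_modEq n
  · exact seq_gamma_modEq n
  · exact seq_s7_modEq n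
  · exact seq_s10_modEq n
  · exact seq_s18_modEq n

/-! ### The largest modulus -/

theorem seq_one (s : AperyLike) : s.seq 1 = s.tableFirstTerm := by cases s <;> rfl

theorem gcdModulus_tableFirstTerm (s : AperyLike) :
    s.gcdModulus s.tableFirstTerm = s.tableModulus := by
  cases s <;> rfl

theorem tableModulus_pos (s : AperyLike) : 0 < s.tableModulus := by cases s <;> decide

theorem transform_one (s : AperyLike) : s.transform 1 (s.seq 1) = 0 := by
  simp [transform, sum_range_succ, seq_zero]

/-- Every admissible modulus divides the values of the binomial transform. -/
theorem dvd_transform {s : AperyLike} {α : ℤ} {N : ℕ} (hN : N ∈ s.moduli α) {n : ℕ} (hn : 0 < n) :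
    (N : ℤ) ∣ s.transform n α := by
  have h : s.transform n α
      ≡ ∑ k ∈ range (n + 1), (n.choose k : ℤ) * (-α) ^ (n - k) * α ^ k [ZMOD (N : ℤ)] :=
    Int.ModEq.sum fun k _ => (hN.2 k).mul_left _
  have h0 : ∑ k ∈ range (n + 1), (n.choose k : ℤ) * (-α) ^ (n - k) * α ^ k = 0 := by
    have := add_pow α (-α) n
    rw [add_neg_cancel, zero_pow hn.ne'] at this
    rw [this]
    exact sum_congr rfl fun k _ => by ring
  rw [h0] at h
  exact Int.modEq_zero_iff_dvd.1 h

theorem dvd_gcdModulus {s : AperyLike} {α : ℤ} {N : ℕ} (hN : N ∈ s.moduli α) :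
    N ∣ s.gcdModulus α := by
  have h : ∀ n, 0 < n → N ∣ (s.transform n α).natAbs := fun n hn =>
    Int.natCast_dvd.1 (dvd_transform hN hn)
  unfold gcdModulus
  split
  · exact Nat.dvd_gcd (h 1 one_pos) (Nat.dvd_gcd (h 2 two_pos) (h 3 three_pos))
  · exact Nat.dvd_gcd (h 1 one_pos) (Nat.dvd_gcd (h 2 two_pos)
      (Nat.dvd_gcd (h 3 three_pos) (h 4 four_pos)))

/-- The congruence at `n = 1` forces `α ≡ u_1`, so `α` may be replaced by `u_1`. One bound thus
serves all `α`. -/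
theorem moduli_subset (s : AperyLike) (α : ℤ) : s.moduli α ⊆ s.moduli (s.seq 1) := by
  intro N hN
  refine ⟨hN.1, fun n => (hN.2 n).trans ?_⟩
  have h1 := (hN.2 1).symm
  rw [pow_one] at h1
  exact h1.pow n

theorem dvd_tableModulus {s : AperyLike} {α : ℤ} {N : ℕ} (hN : N ∈ s.moduli α) :
    N ∣ s.tableModulus := by
  have h := dvd_gcdModulus (moduli_subset s α hN)
  rwa [seq_one, gcdModulus_tableFirstTerm] at h

/-- The modulus 1 is always admissible and `tableModulus` bounds all others, so the supremum is
attained and is not the default value 0. -/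
theorem isGreatest_maxModulus (s : AperyLike) (α : ℤ) :
    IsGreatest (s.moduli α) (s.maxModulus α) := by
  have hb : BddAbove (s.moduli α) :=
    ⟨s.tableModulus, fun _ hN => Nat.le_of_dvd s.tableModulus_pos (dvd_tableModulus hN)⟩
  have hne : (s.moduli α).Nonempty := ⟨1, one_pos, fun n => by simpa using Int.modEq_one⟩
  exact ⟨Nat.sSup_mem hne hb, fun _ hN => le_csSup hb hN⟩

theorem maxModulus_seq_one (s : AperyLike) : s.maxModulus (s.seq 1) = s.tableModulus := by
  have hg := s.isGreatest_maxModulus (s.seq 1)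
  have hmem : s.tableModulus ∈ s.moduli (s.seq 1) :=
    ⟨s.tableModulus_pos, by rw [seq_one]; exact s.seq_modEq⟩
  exact (Nat.le_of_dvd s.tableModulus_pos (dvd_tableModulus hg.1)).antisymm (hg.2 hmem)

end AperyLike

theorem theorem2 (s : AperyLike) :
    (∀ α : ℤ, IsGreatest (s.moduli α) (s.maxModulus α)) ∧
    (∀ α : ℤ, s.maxModulus α ∣ s.maxModulus (s.seq 1)) ∧
    s.maxModulus (s.seq 1) = s.gcdModulus (s.seq 1) ∧
    (s.kind = AperyKind.second →
      s.gcdModulus (s.seq 1) =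
        Nat.gcd (s.transform 2 (s.seq 1)).natAbs (s.transform 3 (s.seq 1)).natAbs) ∧
    (s.kind = AperyKind.first →
      s.gcdModulus (s.seq 1) =
        Nat.gcd (s.transform 2 (s.seq 1)).natAbs
          (Nat.gcd (s.transform 3 (s.seq 1)).natAbs (s.transform 4 (s.seq 1)).natAbs)) ∧
    s.seq 1 = s.tableFirstTerm ∧
    s.maxModulus (s.seq 1) = s.tableModulus ∧
    (∀ n : ℕ, s.seq n ≡ s.tableFirstTerm ^ n [ZMOD (s.tableModulus : ℤ)]) := by
  refine ⟨s.isGreatest_maxModulus, fun α => ?_, ?_, fun h => ?_, fun h => ?_, s.seq_one,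
    s.maxModulus_seq_one, s.seq_modEq⟩
  · rw [s.maxModulus_seq_one]
    exact AperyLike.dvd_tableModulus (s.isGreatest_maxModulus α).1
  · rw [s.maxModulus_seq_one, s.seq_one, s.gcdModulus_tableFirstTerm]
  -- The entry `v_1(u_1)` is zero and drops out of the gcd.
  · simp [AperyLike.gcdModulus, h, s.transform_one]
  · simp [AperyLike.gcdModulus, h, s.transform_one]
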